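/- Let $X$ be a real random variable whose distribution $F$ is symmetric about $0$. Suppose that for some $x_0>1$ the distribution function $F$ is absolutely continuous on $[x_0,\infty)$, with a density $f=F'$ that is continuous and strictly positive on $[x_0,\infty)$, and put $f(-x)=f(x)$ for $x\ge x_0$. Assume that $$\int_{|x|\ge x_0}\frac{-\ln f(x)}{x^2\,\ln|x|}\,dx=\infty \qquad (1)$$ and that $$\frac{-\ln f(x)}{\ln x}\ \text{ is nondecreasing on } [x_0,\infty) \text{ and tends to } \infty \text{ as } x\to\infty. \qquad (2)$$ Then all moments of $X$ are finite and $X$ satisfies Carleman's condition $$\sum_{k=1}^{\infty}\bigl(\mathbf{E}[X^{2k}]\bigr)^{-1/(2k)}=\infty ;$$ $X$ is moment-determinate, that is, $F$ is the only probability distribution on $\mathbb{R}$ with finite moments $\mathbf{E}[X^k]$, $k=1,2,\dots$; and $X^2$ is moment-determinate on $\mathbb{R}_+=[0,\infty)$, that is, the distribution of $X^2$ is the only probability distribution on $[0,\infty)$ with moments $\mathbf{E}[X^{2k}]$, $k=1,2,\dots$. -/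

import Mathlib

open MeasureTheory ProbabilityTheory Filter Set
open scoped ENNReal

noncomputable section

namespace MomentProblem

/-- All moments of the distribution `μ` on the line are finite. -/
def FiniteMoments (μ : Measure ℝ) : Prop :=
  ∀ k : ℕ, Integrable (fun x : ℝ => x ^ k) μ

/-- The moment of order `k` of the distribution `μ`. -/
def moment (μ : Measure ℝ) (k : ℕ) : ℝ :=
  ∫ x, x ^ k ∂μ

/-- `μ` is a distribution on `S` with finite moments, and it is the only probability
distribution on `S` with its moment sequence. -/
def MDeterminateOn (S : Set ℝ) (μ : Measure ℝ) : Prop :=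
  μ Sᶜ = 0 ∧ FiniteMoments μ ∧
    ∀ ν : Measure ℝ, IsProbabilityMeasure ν → ν Sᶜ = 0 → FiniteMoments ν →
      (∀ k : ℕ, moment ν k = moment μ k) → ν = μ

/-- Carleman's condition on the whole line: all moments are finite and
`∑ k ≥ 1, (m_{2k}) ^ (-1/(2k)) = ∞`. The sum is a sum of `[0, ∞]`-valued terms, and the
summation index is shifted by one. -/
def Carleman (μ : Measure ℝ) : Prop :=
  FiniteMoments μ ∧
    ∑' k : ℕ, ENNReal.ofReal (moment μ (2 * (k + 1))) ^ (-1 / (2 * ((k : ℝ) + 1))) = ∞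

/-- The distribution `μ` is symmetric about the origin. -/
def SymmetricLaw (μ : Measure ℝ) : Prop :=
  μ.map (fun x => -x) = μ

/-- The distribution function of `μ` is absolutely continuous on `[a, ∞)` with density `f`
there: for every Borel set `B` of `(a, ∞)`, `μ B = ∫ x in B, f x`. As a jump of the distribution
function at `a` does not affect its absolute continuity on `[a, ∞)`, an atom of `μ` at `a`
is not excluded. -/
def HasDensityFrom (μ : Measure ℝ) (a : ℝ) (f : ℝ → ℝ) : Prop :=
  μ.restrict (Ioi a) = (volume.restrict (Ioi a)).withDensity (fun x => ENNReal.ofReal (f x))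

/-- The Lebesgue integral of `g` over `s` as an extended real number: the integral of the positive
part minus that of the negative part. It equals `⊤` exactly if the first is infinite and the
second is finite (as `⊤ - ⊤ = ⊥` in `EReal`). -/
def extIntegral (s : Set ℝ) (g : ℝ → ℝ) : EReal :=
  ((∫⁻ x in s, ENNReal.ofReal (g x) : ℝ≥0∞) : EReal) -
    ((∫⁻ x in s, ENNReal.ofReal (-g x) : ℝ≥0∞) : EReal)

/-- The logarithmic integral `∫_{|x| ≥ a} -ln f(x) / (x² ln |x|) dx` of a density `f` which is
given on `[a, ∞)` and extended to `(-∞, -a]` by symmetry. -/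
def Kstar (a : ℝ) (f : ℝ → ℝ) : EReal :=
  extIntegral {x | a ≤ |x|} (fun x => -Real.log (f |x|) / (x ^ 2 * Real.log |x|))

end MomentProblem

end

namespace MomentProblem

/-! Write `f x = x ^ (-q x)` with `q = -log f / log`, and let `b k` be the point where the
nondecreasing `q` passes the level `2k + 4`. Beyond `b k` the density is at most `x ^ (-(2k + 4))`,
so `E X ^ (2k + 2) ≤ 3 (b k) ^ (2k + 2)`, and the Carleman term is at least `1 / (3 b k)`.
Conversely `q x ≤ 4 + 2 #{k | b k ≤ x}`; integrated against `x⁻²` over `(a, ∞)`, this bounds the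
logarithmic integral by `4 / a + 2 ∑ 1 / b k`. Its divergence therefore forces Carleman's condition
(`lintegral_abs_pow_le`, `tsum_inv_threshold_eq_top`).

Carleman's condition gives determinacy by quasi-analyticity. If `ν` has the moments of `μ`, the
difference of the characteristic functions is flat at `0`, and its derivatives are bounded by the
log-convex absolute moments `M n` of `μ + ν`. Carleman's inequality turns the condition into `∑ M n
/ M (n + 1) = ∞`, and Bang's argument (`eq_zero_of_not_summable_ratio`) makes the difference vanish.

For `X²`, a competitor on `[0, ∞)` is lifted to a symmetric law by a random sign times the square
root, and determinacy on the line applies to the lift. -/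

/-! ### Quasi-analyticity: the Denjoy–Carleman theorem by Bang's method. -/

/-- Bang's estimate: along an interval of length `M N / (e * M (N + 1))` the Bang degree
drops by at most one. -/
theorem bang_step {F : ℕ → ℝ → ℂ} {M : ℕ → ℝ} (hM : ∀ n, 0 < M n)
    (hF : ∀ n t, HasDerivAt (F n) (F (n + 1) t) t) (hb : ∀ n t, ‖F n t‖ ≤ M n)
    (hlc : ∀ n, M (n + 1) ^ 2 ≤ M n * M (n + 2)) (N : ℕ) (x : ℝ)
    (hx : ∀ j : ℕ, ‖F j x‖ ≤ Real.exp (j - (N + 1)) * M j)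
    {s : ℝ} (hs0 : 0 ≤ s) (hs : s ≤ Real.exp (-1) * (M N / M (N + 1))) (j : ℕ) :
    ‖F j (x + s)‖ ≤ Real.exp (j - N) * M j := by
  set r : ℕ → ℝ := fun n => M (n + 1) / M n with hr
  have hr_mono : Monotone r := by
    refine monotone_nat_of_le_succ fun n => ?_
    rw [hr, div_le_div_iff₀ (hM _) (hM _)]
    nlinarith [hlc n]
  -- Descending induction on the order `j`: at `j = N + 1` the global bound suffices, and below it
  -- the bound for `F (j + 1)` integrates to that for `F j`, since log-convexity gives `M (j + 1) ≤
  -- M j * r N`.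
  have key : ∀ d j : ℕ, j + d = N + 1 → ∀ s : ℝ, 0 ≤ s →
      ‖F j (x + s)‖ ≤ Real.exp (j - (N + 1)) * M j * Real.exp (Real.exp 1 * r N * s) := by
    have hrN : 0 ≤ Real.exp 1 * r N :=
      mul_nonneg (Real.exp_pos _).le (div_nonneg (hM _).le (hM _).le)
    intro d
    induction d with
    | zero =>
      intro j hj s hs
      have hj' : (j : ℝ) - (N + 1) = 0 := by
        have : (j : ℝ) = N + 1 := by exact_mod_cast hj
        linarith
      rw [hj', Real.exp_zero, one_mul]
      exact (hb j _).trans (le_mul_of_one_le_right (hM j).le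
        (Real.one_le_exp (mul_nonneg hrN hs)))
    | succ d ih =>
      intro j hj s hs
      have hG : ∀ u, HasDerivAt (fun u => F j (x + u)) (F (j + 1) (x + u)) u := fun u =>
        (hF j (x + u)).comp_const_add x u
      have hB : ∀ u, HasDerivAt
          (fun u => Real.exp (j - (N + 1)) * M j * Real.exp (Real.exp 1 * r N * u))
          (Real.exp (j - (N + 1)) * M j *
            (Real.exp (Real.exp 1 * r N * u) * (Real.exp 1 * r N))) u := fun u => by
        have := ((hasDerivAt_id u).const_mul (Real.exp 1 * r N)).exp.const_mul
          (Real.exp (j - (N + 1)) * M j)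
        simpa using this
      refine image_norm_le_of_norm_deriv_right_le_deriv_boundary (a := 0) (b := s)
        (f := fun u => F j (x + u)) (fun u _ => (hG u).continuousAt.continuousWithinAt)
        (fun u _ => (hG u).hasDerivWithinAt) ?_ hB ?_ ⟨hs, le_rfl⟩
      · simpa using hx j
      · intro u hu
        refine (ih (j + 1) (by omega) u hu.1).trans ?_
        have h1 : M (j + 1) ≤ M j * r N := by
          have : r j ≤ r N := hr_mono (by omega)
          rw [hr] at this
          simp only at this
          rwa [div_le_iff₀ (hM j), mul_comm] at this
        have h2 : Real.exp (((j + 1 : ℕ) : ℝ) - (N + 1)) =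
            Real.exp (j - (N + 1)) * Real.exp 1 := by
          rw [← Real.exp_add]; congr 1; push_cast; ring
        rw [h2]
        calc _ ≤ Real.exp (j - (N + 1)) * Real.exp 1 * (M j * r N) *
              Real.exp (Real.exp 1 * r N * u) := by gcongr
          _ = _ := by ring
  -- For `j ≤ N` the growth factor is at most `e` on this interval; for `j > N` the claim is weaker
  -- than `hb`.
  rcases le_or_gt j N with hj | hj
  · refine (key (N + 1 - j) j (by omega) s hs0).trans ?_
    have h1 : Real.exp 1 * r N * s ≤ 1 := by
      calc Real.exp 1 * r N * s ≤ Real.exp 1 * r N * (Real.exp (-1) * (M N / M (N + 1))) := by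
            gcongr
            exact mul_nonneg (Real.exp_pos _).le (div_nonneg (hM _).le (hM _).le)
        _ = 1 := by
            have := hM N
            have := hM (N + 1)
            rw [Real.exp_neg]
            simp only [hr]
            field_simp
    have h2 : Real.exp ((j : ℝ) - N) = Real.exp (j - (N + 1)) * Real.exp 1 := by
      rw [← Real.exp_add]; congr 1; ring
    rw [h2, mul_right_comm]
    have := hM j
    gcongr
  · refine (hb j _).trans (le_mul_of_one_le_left (hM j).le (Real.one_le_exp ?_))
    have : (N : ℝ) ≤ j := by exact_mod_cast hj.le
    linarith

/-- The Denjoy–Carleman theorem on the half-line: a smooth function with all derivatives bounded by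
a logarithmically convex sequence `M` with `∑ M n / M (n + 1) = ∞` vanishes on `[0, ∞)` if it
vanishes at `0` with all its derivatives. -/
theorem eq_zero_of_not_summable_ratio {F : ℕ → ℝ → ℂ} {M : ℕ → ℝ} (hM : ∀ n, 0 < M n)
    (hF : ∀ n t, HasDerivAt (F n) (F (n + 1) t) t) (hb : ∀ n t, ‖F n t‖ ≤ M n)
    (hlc : ∀ n, M (n + 1) ^ 2 ≤ M n * M (n + 2))
    (hsum : ¬ Summable fun n => M n / M (n + 1)) (h0 : ∀ n, F n 0 = 0) {t : ℝ} (ht : 0 ≤ t) :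
    F 0 t = 0 := by
  have key : ∀ N d : ℕ, ∀ s : ℝ, 0 ≤ s →
      s ≤ Real.exp (-1) * ∑ i ∈ Finset.range d, M (N + i) / M (N + i + 1) →
      ∀ j : ℕ, ‖F j s‖ ≤ Real.exp (j - N) * M j := by
    intro N d
    induction d generalizing N with
    | zero =>
      intro s hs hs' j
      have : s = 0 := le_antisymm (by simpa using hs') hs
      rw [this, h0, norm_zero]
      exact mul_nonneg (Real.exp_pos _).le (hM _).le
    | succ d ih =>
      intro s hs hs' j
      rw [Finset.sum_range_succ'] at hs'
      set T := Real.exp (-1) * ∑ i ∈ Finset.range d, M (N + (i + 1)) / M (N + (i + 1) + 1)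
      have hT : 0 ≤ T := mul_nonneg (Real.exp_pos _).le
        (Finset.sum_nonneg fun i _ => div_nonneg (hM _).le (hM _).le)
      -- The first `d` intervals, counted from `0`, lower the degree to `N + 1`; the last one lowers
      -- it to `N`. The minimum covers points `s` that lie before `T`.
      have h1 : ∀ j : ℕ, ‖F j (min s T)‖ ≤ Real.exp (j - (N + 1)) * M j := by
        intro j
        have := ih (N + 1) (min s T) (le_min hs hT) ((min_le_right _ _).trans_eq ?_) j
        · simpa using this
        · simp only [T]
          congr 1
          refine Finset.sum_congr rfl fun i _ => ?_
          rw [show N + 1 + i = N + (i + 1) by ring]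
      have h2 := bang_step hM hF hb hlc N (min s T) h1 (s := s - min s T)
        (sub_nonneg.2 (min_le_left _ _)) ?_ j
      · simpa using h2
      · rw [mul_add] at hs'
        rcases min_choice s T with h | h <;> rw [h]
        · simpa using mul_nonneg (Real.exp_pos _).le (div_nonneg (hM _).le (hM _).le)
        · simp only [add_zero] at hs'
          linarith
  -- Every tail of the ratio series diverges, so `t` is reached from `0` with degree `N` still left,
  -- for every `N`.
  have hbd : ∀ N : ℕ, ‖F 0 t‖ ≤ Real.exp (-N) * M 0 := by
    intro N
    have hdiv : Tendsto (fun d => ∑ i ∈ Finset.range d, M (N + i) / M (N + i + 1))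
        atTop atTop := by
      refine (not_summable_iff_tendsto_nat_atTop_of_nonneg
        fun n => div_nonneg (hM _).le (hM _).le).1 fun h => hsum ?_
      refine (summable_nat_add_iff N).1 (h.congr fun n => ?_)
      rw [add_comm N n]
    obtain ⟨d, hd⟩ := (hdiv.eventually_ge_atTop (Real.exp 1 * t)).exists
    have := key N d t ht ?_ 0
    · simpa using this
    · calc t = Real.exp (-1) * (Real.exp 1 * t) := by
            rw [← mul_assoc, ← Real.exp_add]; simp
        _ ≤ _ := by gcongr
  have hlim : Tendsto (fun N : ℕ => Real.exp (-N) * M 0) atTop (nhds 0) := by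
    simpa using ((Real.tendsto_exp_neg_atTop_nhds_zero.comp
      tendsto_natCast_atTop_atTop).mul_const (M 0))
  exact norm_le_zero_iff.1 (ge_of_tendsto' hlim hbd)

/-! ### Carleman's inequality. -/

theorem pow_succ_div_pow_le (i : ℕ) :
    ((i : ℝ) + 2) ^ (i + 1) / ((i : ℝ) + 1) ^ i ≤ Real.exp 1 * (i + 1) := by
  have hi : (0 : ℝ) < (i : ℝ) + 1 := by positivity
  have h1 : ((i : ℝ) + 2) / (i + 1) ≤ Real.exp (1 / (i + 1)) := by
    have := Real.add_one_le_exp (1 / ((i : ℝ) + 1))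
    refine le_trans (le_of_eq ?_) this
    field_simp
    ring
  have h2 : (((i : ℝ) + 2) / (i + 1)) ^ (i + 1) ≤ Real.exp 1 := by
    calc _ ≤ Real.exp (1 / (i + 1)) ^ (i + 1) := by gcongr
      _ = Real.exp 1 := by
        rw [← Real.exp_nat_mul]
        congr 1
        push_cast
        field_simp
  calc ((i : ℝ) + 2) ^ (i + 1) / ((i : ℝ) + 1) ^ i
      = (((i : ℝ) + 2) / (i + 1)) ^ (i + 1) * (i + 1) := by
        rw [div_pow, pow_succ ((i : ℝ) + 1) i]
        field_simp
    _ ≤ _ := by gcongr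

/-- Carleman's inequality for partial sums. -/
theorem sum_prod_rpow_le {a : ℕ → ℝ} (ha : ∀ n, 0 ≤ a n) (K : ℕ) :
    ∑ n ∈ Finset.range K, (∏ i ∈ Finset.range (n + 1), a i) ^ (1 / ((n : ℝ) + 1)) ≤
      Real.exp 1 * ∑ n ∈ Finset.range K, a n := by
  -- Weights for AM–GM: the first `n + 1` of them have geometric mean exactly `n + 2`, and `c i ≤ e
  -- (i + 1)`.
  set c : ℕ → ℝ := fun i => ((i : ℝ) + 2) ^ (i + 1) / ((i : ℝ) + 1) ^ i with hc
  have hc0 : ∀ i, 0 < c i := fun i => by positivity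
  have hprod : ∀ n, ∏ i ∈ Finset.range n, c i = ((n : ℝ) + 1) ^ n := by
    intro n
    induction n with
    | zero => simp
    | succ n ih =>
      rw [Finset.prod_range_succ, ih, hc]
      push_cast
      field_simp
      ring
  have hterm : ∀ n : ℕ, (∏ i ∈ Finset.range (n + 1), a i) ^ (1 / ((n : ℝ) + 1)) ≤
      (∑ i ∈ Finset.range (n + 1), c i * a i) / ((n + 1) * (n + 2)) := by
    intro n
    have hn : (0 : ℝ) < (n : ℝ) + 1 := by positivity
    have h := Real.geom_mean_le_arith_mean (Finset.range (n + 1)) (fun _ => 1)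
      (fun i => c i * a i) (by simp) (by simp; positivity)
      (fun i _ => mul_nonneg (hc0 i).le (ha i))
    simp only [Real.rpow_one, Finset.sum_const, Finset.card_range, nsmul_eq_mul, mul_one,
      one_mul, Finset.prod_mul_distrib, hprod] at h
    rw [Real.mul_rpow (by positivity) (Finset.prod_nonneg fun i _ => ha i),
      Real.pow_rpow_inv_natCast (by positivity) (by omega)] at h
    push_cast at h
    rw [one_div, ← div_div, le_div_iff₀ (by positivity)]
    refine le_trans (le_of_eq ?_) h
    ring
  -- Interchange of the two sums, using `1 / ((n + 1) (n + 2)) = 1 / (n + 1) - 1 / (n + 2)`.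
  have htel : ∀ K : ℕ, ∑ n ∈ Finset.range K,
      (∑ i ∈ Finset.range (n + 1), c i * a i) / (((n : ℝ) + 1) * (n + 2)) =
      ∑ i ∈ Finset.range K, c i * a i / (i + 1) -
        (∑ i ∈ Finset.range K, c i * a i) / (K + 1) := by
    intro K
    induction K with
    | zero => simp
    | succ K ih =>
      rw [Finset.sum_range_succ, ih, Finset.sum_range_succ (fun i : ℕ => c i * a i / ((i : ℝ) + 1)),
        Finset.sum_range_succ (fun i : ℕ => c i * a i)]
      push_cast
      field_simp
      ring
  calc _ ≤ _ := Finset.sum_le_sum fun n _ => hterm n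
    _ = _ := htel K
    _ ≤ ∑ i ∈ Finset.range K, c i * a i / (i + 1) := sub_le_self _ (div_nonneg
        (Finset.sum_nonneg fun i _ => mul_nonneg (hc0 i).le (ha i)) (by positivity))
    _ ≤ ∑ i ∈ Finset.range K, Real.exp 1 * a i := by
        refine Finset.sum_le_sum fun i _ => ?_
        rw [div_le_iff₀ (by positivity)]
        calc c i * a i ≤ Real.exp 1 * (i + 1) * a i :=
              mul_le_mul_of_nonneg_right (pow_succ_div_pow_le i) (ha i)
          _ = _ := by ring
    _ = _ := by rw [Finset.mul_sum]

/-- Carleman's inequality applied to the ratios `M n / M (n + 1)`, whose partial products telescope.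
-/
theorem summable_rpow_of_summable_ratio {M : ℕ → ℝ} (hM : ∀ n, 0 < M n)
    (h : Summable fun n => M n / M (n + 1)) :
    Summable fun n : ℕ => (M 0 / M (n + 1)) ^ (1 / ((n : ℝ) + 1)) := by
  have h0 : ∀ n, 0 ≤ M n / M (n + 1) := fun n => div_nonneg (hM _).le (hM _).le
  have hprod : ∀ n, ∏ i ∈ Finset.range n, M i / M (i + 1) = M 0 / M n := by
    intro n
    induction n with
    | zero => simp [(hM 0).ne']
    | succ n ih =>
      rw [Finset.prod_range_succ, ih, div_mul_div_cancel₀ (hM n).ne']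
  refine summable_of_sum_range_le (c := Real.exp 1 * ∑' n, M n / M (n + 1))
    (fun n => Real.rpow_nonneg (div_nonneg (hM _).le (hM _).le) _) fun K => ?_
  simp_rw [← hprod]
  exact (sum_prod_rpow_le h0 K).trans
    (mul_le_mul_of_nonneg_left (h.sum_le_tsum _ fun i _ => h0 i) (Real.exp_pos _).le)

/-! ### Characteristic functions and the Hamburger moment problem. -/

theorem FiniteMoments.memLp_id {μ : Measure ℝ} (h : FiniteMoments μ) (n : ℕ) : MemLp id n μ := by
  rcases Nat.eq_zero_or_pos n with rfl | hn
  · simpa using aestronglyMeasurable_id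
  · refine (integrable_norm_rpow_iff aestronglyMeasurable_id (by simpa using hn.ne')
      (by simp)).1 ?_
    simpa using (h n).abs

theorem FiniteMoments.integrable_abs_pow {μ : Measure ℝ} (h : FiniteMoments μ) (n : ℕ) :
    Integrable (fun x : ℝ => |x| ^ n) μ := by
  simpa [abs_pow] using (h n).abs

theorem norm_iteratedDeriv_charFun_le {μ : Measure ℝ} [IsFiniteMeasure μ] (h : FiniteMoments μ)
    (n : ℕ) (t : ℝ) : ‖iteratedDeriv n (charFun μ) t‖ ≤ ∫ x, |x| ^ n ∂μ := by
  rw [iteratedDeriv_charFun (h.memLp_id n), norm_mul, norm_pow, Complex.norm_I, one_pow, one_mul]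
  refine (norm_integral_le_integral_norm _).trans (le_of_eq ?_)
  congr 1
  ext x
  rw [norm_mul, ← Complex.ofReal_mul, Complex.norm_exp_ofReal_mul_I]
  simp

theorem hasDerivAt_iteratedDeriv_charFun {μ : Measure ℝ} [IsFiniteMeasure μ]
    (h : FiniteMoments μ) (n : ℕ) (t : ℝ) :
    HasDerivAt (iteratedDeriv n (charFun μ)) (iteratedDeriv (n + 1) (charFun μ) t) t := by
  rw [iteratedDeriv_succ]
  have h1 : ContDiff ℝ (n + 1 : ℕ) (charFun μ) := contDiff_charFun (h.memLp_id (n + 1))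
  exact ((h1.differentiable_iteratedDeriv n (by exact_mod_cast n.lt_succ_self)) t).hasDerivAt

/-- Absolute moments are logarithmically convex. -/
theorem sq_integral_abs_pow_le {σ : Measure ℝ} (h : ∀ n : ℕ, Integrable (fun x : ℝ => |x| ^ n) σ)
    (n : ℕ) :
    (∫ x, |x| ^ (n + 1) ∂σ) ^ 2 ≤ (∫ x, |x| ^ n ∂σ) * ∫ x, |x| ^ (n + 2) ∂σ := by
  -- The quadratic is `∫ |x| ^ n (t - |x|) ^ 2`, so its discriminant is nonpositive.
  have hq : ∀ t : ℝ, 0 ≤ (∫ x, |x| ^ n ∂σ) * (t * t) + (-2 * ∫ x, |x| ^ (n + 1) ∂σ) * t +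
      ∫ x, |x| ^ (n + 2) ∂σ := by
    intro t
    have : 0 ≤ ∫ x, |x| ^ n * (t - |x|) ^ 2 ∂σ := integral_nonneg fun x => by positivity
    refine this.trans_eq ?_
    rw [← integral_mul_const, ← integral_const_mul, ← integral_mul_const, ← integral_add,
      ← integral_add]
    · congr 1
      ext x
      ring
    · exact ((h _).mul_const _).add (((h _).const_mul _).mul_const _)
    · exact h _
    · exact (h _).mul_const _
    · exact ((h _).const_mul _).mul_const _
  have := discrim_le_zero hq
  rw [discrim] at this
  nlinarith

theorem charFun_eq_of_nonneg {μ ν : Measure ℝ}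
    (h : ∀ t : ℝ, 0 ≤ t → charFun μ t = charFun ν t) : charFun μ = charFun ν := by
  ext t
  rcases le_total 0 t with ht | ht
  · exact h t ht
  · have := h (-t) (by linarith)
    rw [charFun_neg, charFun_neg] at this
    exact (starRingEnd ℂ).injective this

/-- Carleman's criterion for the Hamburger moment problem. -/
theorem Carleman.mDeterminateOn_univ {μ : Measure ℝ} [IsProbabilityMeasure μ] (h : Carleman μ)
    (h0 : μ {0}ᶜ ≠ 0) : MDeterminateOn univ μ := by
  obtain ⟨hμ, hsum⟩ := h
  refine ⟨by simp, hμ, fun ν hν _ hνm hmom => ?_⟩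
  -- Odd absolute moments of `μ` and `ν` may differ; those of the sum dominate both and are still
  -- log-convex.
  set M : ℕ → ℝ := fun n => ∫ x, |x| ^ n ∂(μ + ν) with hMdef
  have hint : ∀ n : ℕ, Integrable (fun x : ℝ => |x| ^ n) (μ + ν) := fun n =>
    (hμ.integrable_abs_pow n).add_measure (hνm.integrable_abs_pow n)
  have hMadd : ∀ n, M n = ∫ x, |x| ^ n ∂μ + ∫ x, |x| ^ n ∂ν := fun n =>
    integral_add_measure (hμ.integrable_abs_pow n) (hνm.integrable_abs_pow n)
  have hMpos : ∀ n, 0 < M n := by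
    intro n
    refine (integral_pos_iff_support_of_nonneg (fun x => by positivity) (hint n)).2 ?_
    refine lt_of_lt_of_le (pos_iff_ne_zero.2 h0) ?_
    refine le_trans (measure_mono fun x hx => ?_) (Measure.le_add_right le_rfl _)
    simpa using fun h : x = 0 => absurd h hx
  have hM0 : M 0 = 2 := by
    rw [hMadd]
    norm_num
  have hMeven : ∀ k : ℕ, M (2 * k) = 2 * moment μ (2 * k) := by
    intro k
    rw [hMadd, two_mul (moment μ (2 * k))]
    congr 1
    · exact integral_congr_ae (ae_of_all _ fun x => by simp [pow_mul])
    · rw [← hmom]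
      exact integral_congr_ae (ae_of_all _ fun x => by simp [pow_mul])
  have hns : ¬ Summable fun n => M n / M (n + 1) := by
    intro hs
    have h1 := summable_rpow_of_summable_ratio hMpos hs
    -- Only the even orders `2 (k + 1)` are kept: there `M` is twice the common moment, and the
    -- factor cancels against `M 0 = 2`.
    have h2 := h1.comp_injective (i := fun k : ℕ => 2 * k + 1)
      (fun a b hab => by simpa using hab)
    refine h2.tsum_ofReal_ne_top (Eq.trans (tsum_congr fun k => ?_) hsum)
    have hpos : 0 < moment μ (2 * (k + 1)) := by
      have := hMpos (2 * (k + 1))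
      rw [hMeven] at this
      linarith
    simp only [Function.comp]
    rw [show 2 * k + 1 + 1 = 2 * (k + 1) by ring, hMeven, hM0,
      ENNReal.ofReal_rpow_of_pos hpos, ← div_div, div_self two_ne_zero, one_div,
      Real.inv_rpow hpos.le, ← Real.rpow_neg hpos.le]
    congr 2
    push_cast
    rw [neg_div]
    congr 2
    ring
  set F : ℕ → ℝ → ℂ := fun n t =>
    iteratedDeriv n (charFun μ) t - iteratedDeriv n (charFun ν) t with hFdef
  refine (Measure.ext_of_charFun (charFun_eq_of_nonneg fun t ht => ?_)).symm
  have := eq_zero_of_not_summable_ratio (F := F) hMpos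
    (fun n t => (hasDerivAt_iteratedDeriv_charFun hμ n t).sub
      (hasDerivAt_iteratedDeriv_charFun hνm n t))
    (fun n t => ?_) (sq_integral_abs_pow_le hint) hns (fun n => ?_) ht
  · simpa [hFdef, sub_eq_zero] using this
  · rw [hMadd]
    exact (norm_sub_le _ _).trans (add_le_add (norm_iteratedDeriv_charFun_le hμ n t)
      (norm_iteratedDeriv_charFun_le hνm n t))
  · have hm : ∫ x, x ^ n ∂ν = ∫ x, x ^ n ∂μ := hmom n
    simp only [hFdef]
    rw [iteratedDeriv_charFun_zero (hμ.memLp_id n), iteratedDeriv_charFun_zero (hνm.memLp_id n),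
      hm, sub_self]

/-! ### From a symmetric law to its square. -/

theorem moment_eq_zero_of_odd {μ : Measure ℝ} (h : SymmetricLaw μ) {k : ℕ} (hk : Odd k) :
    moment μ k = 0 := by
  have h1 : moment μ k = -moment μ k := by
    conv_lhs => rw [moment, ← h, integral_map (by fun_prop) (by fun_prop)]
    simp_rw [hk.neg_pow]
    rw [integral_neg, moment]
  linarith

theorem symmetricLaw_half_add {ν : Measure ℝ} :
    SymmetricLaw ((2⁻¹ : ℝ≥0∞) • (ν.map Real.sqrt + ν.map fun x => -Real.sqrt x)) := by
  rw [SymmetricLaw, Measure.map_smul, Measure.map_add _ _ measurable_neg,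
    Measure.map_map measurable_neg (by fun_prop), Measure.map_map measurable_neg (by fun_prop),
    add_comm]
  congr 2
  congr 1
  ext x
  simp

/-- If a symmetric law is determined by its moments, then its image under squaring is determined
by its moments among the laws on `[0, ∞)`. -/
theorem MDeterminateOn.map_sq {μ : Measure ℝ} [IsProbabilityMeasure μ]
    (h : MDeterminateOn univ μ) (hs : SymmetricLaw μ) :
    MDeterminateOn (Ici 0) (μ.map fun x => x ^ 2) := by
  obtain ⟨-, hμ, huniq⟩ := h
  have hsq : Measurable fun x : ℝ => x ^ 2 := by fun_prop
  have hmomsq : ∀ k, moment (μ.map fun x => x ^ 2) k = moment μ (2 * k) := fun k => by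
    rw [moment, integral_map hsq.aemeasurable (by fun_prop), moment]
    simp_rw [pow_mul]
  refine ⟨?_, fun k => ?_, fun ν hν hν0 hνm hmom => ?_⟩
  · rw [Measure.map_apply hsq measurableSet_Ici.compl]
    convert measure_empty (μ := μ)
    ext x
    simpa using sq_nonneg x
  · rw [integrable_map_measure (by fun_prop) hsq.aemeasurable]
    simpa [Function.comp_def, pow_mul] using hμ (2 * k)
  have hnn : ∀ᵐ x ∂ν, 0 ≤ x := by
    rw [ae_iff]
    convert hν0 using 2
    ext x
    simp
  set ρ : Measure ℝ := (2⁻¹ : ℝ≥0∞) • (ν.map Real.sqrt + ν.map fun x => -Real.sqrt x) with hρ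
  have hm1 : Measurable Real.sqrt := by fun_prop
  have hm2 : Measurable fun x => -Real.sqrt x := by fun_prop
  have hp1 : IsProbabilityMeasure (ν.map Real.sqrt) :=
    Measure.isProbabilityMeasure_map hm1.aemeasurable
  have hp2 : IsProbabilityMeasure (ν.map fun x => -Real.sqrt x) :=
    Measure.isProbabilityMeasure_map hm2.aemeasurable
  have hρp : IsProbabilityMeasure ρ := by
    constructor
    rw [hρ, Measure.smul_apply, Measure.add_apply, measure_univ, measure_univ, smul_eq_mul,
      one_add_one_eq_two, ENNReal.inv_mul_cancel two_ne_zero ENNReal.ofNat_ne_top]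
  -- Half-integer moments are finite because `√x ^ k ≤ 1 + x ^ k` for `x ≥ 0`.
  have hsqrt : ∀ k : ℕ, Integrable (fun x => Real.sqrt x ^ k) ν := by
    intro k
    refine ((integrable_const (1 : ℝ)).add (hνm k)).mono' (by fun_prop) ?_
    filter_upwards [hnn] with x hx
    rw [Real.norm_of_nonneg (by positivity)]
    simp only [Pi.add_apply]
    rcases le_total (Real.sqrt x) 1 with h | h
    · have := pow_le_one₀ (Real.sqrt_nonneg x) h (n := k)
      have := pow_nonneg hx k
      linarith
    · calc Real.sqrt x ^ k ≤ Real.sqrt x ^ (2 * k) := pow_le_pow_right₀ h (by omega)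
        _ = x ^ k := by rw [pow_mul, Real.sq_sqrt hx]
        _ ≤ 1 + x ^ k := by linarith
  have hi1 : FiniteMoments (ν.map Real.sqrt) := fun k => by
    rw [integrable_map_measure (by fun_prop) hm1.aemeasurable]
    exact hsqrt k
  have hi2 : FiniteMoments (ν.map fun x => -Real.sqrt x) := fun k => by
    rw [integrable_map_measure (by fun_prop) hm2.aemeasurable]
    refine ((hsqrt k).const_mul ((-1) ^ k)).congr (ae_of_all _ fun x => ?_)
    simp only [Function.comp]
    rw [neg_pow (Real.sqrt x)]
  have hρm : FiniteMoments ρ := fun k =>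
    ((hi1 k).add_measure (hi2 k)).smul_measure (by simp)
  have heven : ∀ k, moment ρ (2 * k) = moment ν k := by
    intro k
    rw [moment, hρ, integral_smul_measure, integral_add_measure (hi1 _) (hi2 _),
      integral_map hm1.aemeasurable (by fun_prop), integral_map hm2.aemeasurable (by fun_prop)]
    have h1 : ∫ x, Real.sqrt x ^ (2 * k) ∂ν = moment ν k := by
      refine integral_congr_ae ?_
      filter_upwards [hnn] with x hx
      rw [pow_mul, Real.sq_sqrt hx]
    have h2 : ∫ x, (-Real.sqrt x) ^ (2 * k) ∂ν = moment ν k := by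
      rw [← h1]
      simp [pow_mul]
    rw [h1, h2]
    simp
    ring
  have hρμ : ρ = μ := by
    refine huniq ρ hρp (by simp) hρm fun k => ?_
    rcases Nat.even_or_odd' k with ⟨j, rfl | rfl⟩
    · rw [heven, hmom, hmomsq]
    · rw [moment_eq_zero_of_odd hs (by simp), moment_eq_zero_of_odd symmetricLaw_half_add (by simp)]
  have hid : ν.map (fun x => Real.sqrt x ^ 2) = ν := by
    conv_rhs => rw [← Measure.map_id (μ := ν)]
    refine Measure.map_congr ?_
    filter_upwards [hnn] with x hx
    simp [Real.sq_sqrt hx]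
  rw [← hρμ, hρ, Measure.map_smul, Measure.map_add _ _ hsq, Measure.map_map hsq hm1,
    Measure.map_map hsq hm2]
  simp only [Function.comp_def, neg_sq, hid]
  rw [← two_smul ℝ≥0∞ ν, smul_smul, ENNReal.inv_mul_cancel two_ne_zero ENNReal.ofNat_ne_top,
    one_smul]

/-! ### Moment bounds from the tail of the density. -/

theorem lintegral_Ioi_inv_sq {b : ℝ} (hb : 0 < b) :
    ∫⁻ x in Ioi b, ENNReal.ofReal (x ^ 2)⁻¹ = ENNReal.ofReal b⁻¹ := by
  have h1 : ∀ x ∈ Ioi b, x ^ (-2 : ℝ) = (x ^ 2)⁻¹ := fun x hx => by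
    rw [Real.rpow_neg (hb.trans hx).le, Real.rpow_two]
  have h2 : IntegrableOn (fun x : ℝ => (x ^ 2)⁻¹) (Ioi b) :=
    (integrableOn_Ioi_rpow_of_lt (by norm_num) hb).congr_fun h1 measurableSet_Ioi
  rw [← ofReal_integral_eq_lintegral_ofReal h2 (ae_of_all _ fun x => by positivity),
    ← setIntegral_congr_fun measurableSet_Ioi h1, integral_Ioi_rpow_of_lt (by norm_num) hb]
  congr 1
  norm_num
  rw [Real.rpow_neg hb.le, Real.rpow_one]

theorem lintegral_Iio_neg_of_symmetric {μ : Measure ℝ} (hs : SymmetricLaw μ) (b : ℝ)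
    {g : ℝ → ℝ≥0∞} (hg : Measurable g) (heven : ∀ x, g (-x) = g x) :
    ∫⁻ x in Iio (-b), g x ∂μ = ∫⁻ x in Ioi b, g x ∂μ := by
  conv_lhs => rw [← hs]
  rw [setLIntegral_map measurableSet_Iio hg measurable_neg]
  simp_rw [heven]
  congr 2
  ext x
  simp

/-- A polynomial bound on the tail of the density bounds the absolute moments. -/
theorem lintegral_abs_pow_le {μ : Measure ℝ} [IsProbabilityMeasure μ] (hs : SymmetricLaw μ)
    {a b : ℝ} (ha : 1 < a) (hab : a ≤ b) {f : ℝ → ℝ} (hdens : HasDensityFrom μ a f)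
    (hcont : ContinuousOn f (Ici a)) (m : ℕ) (hf : ∀ x, b < x → f x ≤ (x ^ (m + 2))⁻¹) :
    ∫⁻ x, ENNReal.ofReal (|x| ^ m) ∂μ ≤ ENNReal.ofReal (3 * b ^ m) := by
  have hb : 1 < b := ha.trans_le hab
  have hb0 : 0 < b := by linarith
  have hg : Measurable fun x : ℝ => ENNReal.ofReal (|x| ^ m) := by fun_prop
  have hsub : Ioi b ⊆ Ioi a := Ioi_subset_Ioi hab
  have hdens' : μ.restrict (Ioi b) =
      (volume.restrict (Ioi b)).withDensity (fun x => ENNReal.ofReal (f x)) := by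
    rw [← Measure.restrict_restrict_of_subset hsub, hdens,
      restrict_withDensity measurableSet_Ioi, Measure.restrict_restrict_of_subset hsub]
  have hfm : AEMeasurable (fun x => ENNReal.ofReal (f x)) (volume.restrict (Ioi b)) :=
    ((hcont.mono (hsub.trans Ioi_subset_Ici_self)).aemeasurable measurableSet_Ioi).ennreal_ofReal
  have htail : ∫⁻ x in Ioi b, ENNReal.ofReal (|x| ^ m) ∂μ ≤ ENNReal.ofReal b⁻¹ := by
    rw [hdens', lintegral_withDensity_eq_lintegral_mul₀ hfm hg.aemeasurable,
      ← lintegral_Ioi_inv_sq hb0]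
    refine setLIntegral_mono (by fun_prop) fun x hx => ?_
    have hx0 : 0 < x := hb0.trans hx
    rw [Pi.mul_apply, ← ENNReal.ofReal_mul' (by positivity), abs_of_pos hx0]
    refine ENNReal.ofReal_le_ofReal ?_
    calc f x * x ^ m ≤ (x ^ (m + 2))⁻¹ * x ^ m := by
          gcongr
          exact hf x hx
      _ = (x ^ 2)⁻¹ := by
          rw [pow_add]
          field_simp
  have hmid : ∫⁻ x in Icc (-b) b, ENNReal.ofReal (|x| ^ m) ∂μ ≤ ENNReal.ofReal (b ^ m) := by
    calc _ ≤ ∫⁻ x in Icc (-b) b, ENNReal.ofReal (b ^ m) ∂μ := by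
          refine setLIntegral_mono (by fun_prop) fun x hx => ENNReal.ofReal_le_ofReal ?_
          have := abs_le.2 hx
          gcongr
      _ ≤ _ := by
          rw [setLIntegral_const]
          exact mul_le_of_le_one_right' prob_le_one
  have huniv : (univ : Set ℝ) = Icc (-b) b ∪ (Ioi b ∪ Iio (-b)) := by
    ext x
    simp only [mem_univ, mem_union, mem_Icc, mem_Ioi, mem_Iio, true_iff]
    grind
  calc ∫⁻ x, ENNReal.ofReal (|x| ^ m) ∂μ
      = ∫⁻ x in Icc (-b) b ∪ (Ioi b ∪ Iio (-b)), ENNReal.ofReal (|x| ^ m) ∂μ := by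
        rw [← huniv, setLIntegral_univ]
    _ ≤ ENNReal.ofReal (b ^ m) + (ENNReal.ofReal b⁻¹ + ENNReal.ofReal b⁻¹) := by
        refine (lintegral_union_le _ _ _).trans (add_le_add hmid
          ((lintegral_union_le _ _ _).trans (add_le_add htail ?_)))
        rw [lintegral_Iio_neg_of_symmetric hs b hg (by simp)]
        exact htail
    _ ≤ ENNReal.ofReal (3 * b ^ m) := by
        rw [← ENNReal.ofReal_add (by positivity) (by positivity),
          ← ENNReal.ofReal_add (by positivity) (by positivity)]
        -- The constant `3` counts the middle part and two tails, each tail being at most `b⁻¹ ≤ 1 ≤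
        -- b ^ m`.
        refine ENNReal.ofReal_le_ofReal ?_
        have h1 : b⁻¹ ≤ 1 := inv_le_one_of_one_le₀ hb.le
        have h2 : 1 ≤ b ^ m := one_le_pow₀ hb.le
        linarith

/-! ### Level crossings, the logarithmic integral and Carleman's condition. -/

/-- A nondecreasing function on `[a, ∞)` which tends to infinity crosses each level. -/
theorem exists_threshold {q : ℝ → ℝ} {a : ℝ} (hmono : MonotoneOn q (Ici a))
    (hlim : Tendsto q atTop atTop) (c : ℝ) :
    ∃ b, a ≤ b ∧ (∀ x, b < x → c < q x) ∧ ∀ x, a ≤ x → c < q x → b ≤ x := by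
  -- The point `a` is added by hand so that `S` is nonempty even when `q` exceeds `c` from the
  -- start.
  set S : Set ℝ := {x | a ≤ x ∧ (x = a ∨ q x ≤ c)} with hS
  have haS : a ∈ S := ⟨le_rfl, Or.inl rfl⟩
  obtain ⟨B, hB⟩ := eventually_atTop.1 (hlim.eventually_gt_atTop c)
  have hbdd : BddAbove S := by
    refine ⟨max a B, fun x hx => ?_⟩
    rcases hx.2 with rfl | h
    · exact le_max_left _ _
    · refine le_max_of_le_right (le_of_not_gt fun hlt => ?_)
      exact absurd (hB x hlt.le) (not_lt.2 h)
  refine ⟨sSup S, le_csSup hbdd haS, fun x hx => ?_, fun x hx hcx => ?_⟩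
  · by_contra! h
    exact absurd (le_csSup hbdd ⟨(le_csSup hbdd haS).trans hx.le, Or.inr h⟩) (not_le.2 hx)
  · refine csSup_le ⟨a, haS⟩ fun y hy => ?_
    rcases hy.2 with rfl | h
    · exact hx
    · by_contra! hlt
      exact absurd (hmono hx hy.1 hlt.le) (not_le.2 (h.trans_lt hcx))

theorem le_inv_pow_of_lt_neg_log_div_log {y x : ℝ} (hy : 0 < y) (hx : 1 < x) (n : ℕ)
    (h : (n : ℝ) < -Real.log y / Real.log x) : y ≤ (x ^ n)⁻¹ := by
  have hx0 : 0 < x := by linarith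
  rw [lt_div_iff₀ (Real.log_pos hx)] at h
  rw [← Real.log_le_log_iff hy (by positivity), Real.log_inv, Real.log_pow]
  linarith

/-- Subtracting the negative part cannot increase the value, so the positive part is already
infinite; by evenness each half-line carries half of it. -/
theorem lintegral_eq_top_of_Kstar {a : ℝ} (ha : 0 < a) {f : ℝ → ℝ} (hK : Kstar a f = ⊤) :
    ∫⁻ x in Ioi a, ENNReal.ofReal (-Real.log (f x) / Real.log x * (x ^ 2)⁻¹) = ⊤ := by
  set g : ℝ → ℝ := fun x => -Real.log (f |x|) / (x ^ 2 * Real.log |x|) with hg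
  have h1 : ∫⁻ x in {x | a ≤ |x|}, ENNReal.ofReal (g x) = ⊤ := by
    rw [Kstar, extIntegral] at hK
    have h2 := EReal.sub_le_sub
      (le_refl ((∫⁻ x in {x | a ≤ |x|}, ENNReal.ofReal (g x) : ℝ≥0∞) : EReal))
      (EReal.coe_ennreal_nonneg (∫⁻ x in {x | a ≤ |x|}, ENNReal.ofReal (-g x)))
    rw [hK, sub_zero] at h2
    exact EReal.coe_ennreal_eq_top_iff.1 (top_le_iff.1 h2)
  have hset : {x : ℝ | a ≤ |x|} = Ici a ∪ Iic (-a) := by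
    ext x
    simp [le_abs, le_neg]
  have hneg : ∫⁻ x in Iic (-a), ENNReal.ofReal (g x) = ∫⁻ x in Ici a, ENNReal.ofReal (g x) := by
    have := (Measure.measurePreserving_neg (volume : Measure ℝ)).setLIntegral_comp_preimage_emb
      (MeasurableEquiv.neg ℝ).measurableEmbedding (fun x => ENNReal.ofReal (g x)) (Iic (-a))
    rw [← this]
    simp [hg]
  have h3 : ∫⁻ x in Ici a, ENNReal.ofReal (g x) = ⊤ := by
    have h4 := lintegral_union_le (μ := volume) (fun x => ENNReal.ofReal (g x)) (Ici a) (Iic (-a))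
    rw [← hset, h1, hneg, top_le_iff, ENNReal.add_eq_top, or_self] at h4
    exact h4
  rw [setLIntegral_congr Ioi_ae_eq_Ici, ← h3]
  refine setLIntegral_congr_fun measurableSet_Ici fun x (hx : a ≤ x) => ?_
  simp only [hg]
  rw [abs_of_pos (ha.trans_le hx), div_mul_eq_div_div_swap, div_eq_mul_inv _ (x ^ 2)]

/-- A layer-cake count: `q` is at most `4` plus twice the number of thresholds passed, and the
threshold `b k` contributes `∫ x⁻²` over `[b k, ∞)`, which is `1 / b k`. -/
theorem tsum_inv_threshold_eq_top {q : ℝ → ℝ} {a : ℝ} (ha : 0 < a)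
    (hq : ∫⁻ x in Ioi a, ENNReal.ofReal (q x * (x ^ 2)⁻¹) = ⊤) {b : ℕ → ℝ} (hab : ∀ k, a ≤ b k)
    (hb : ∀ (k : ℕ) (x : ℝ), a ≤ x → 2 * (k : ℝ) + 4 < q x → b k ≤ x) :
    ∑' k, ENNReal.ofReal (b k)⁻¹ = ⊤ := by
  have hpt : ∀ x ∈ Ioi a, ENNReal.ofReal (q x * (x ^ 2)⁻¹) ≤
      4 * ENNReal.ofReal (x ^ 2)⁻¹ +
        2 * ∑' k, (Ici (b k)).indicator (fun x => ENNReal.ofReal (x ^ 2)⁻¹) x := by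
    intro x hx
    have hx0 : 0 < x := ha.trans hx
    -- `K` is the number of levels `2k + 4` lying strictly below `q x`.
    set K := ⌈(q x - 4) / 2⌉₊ with hK
    have hqK : q x ≤ 4 + 2 * K := by
      have := Nat.le_ceil ((q x - 4) / 2)
      rw [← hK] at this
      linarith
    have hsum : (K : ℝ≥0∞) * ENNReal.ofReal (x ^ 2)⁻¹ ≤
        ∑' k, (Ici (b k)).indicator (fun x => ENNReal.ofReal (x ^ 2)⁻¹) x := by
      refine le_trans (le_of_eq ?_) (ENNReal.sum_le_tsum (Finset.range K))
      rw [← nsmul_eq_mul, ← Finset.card_range K, ← Finset.sum_const, Finset.card_range]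
      refine Finset.sum_congr rfl fun k hk => ?_
      rw [indicator_of_mem]
      have := Nat.lt_ceil.1 (Finset.mem_range.1 hk)
      exact hb k x (le_of_lt hx) (by linarith)
    calc ENNReal.ofReal (q x * (x ^ 2)⁻¹) ≤ ENNReal.ofReal ((4 + 2 * K) * (x ^ 2)⁻¹) := by
          gcongr
      _ = 4 * ENNReal.ofReal (x ^ 2)⁻¹ + 2 * ((K : ℝ≥0∞) * ENNReal.ofReal (x ^ 2)⁻¹) := by
          rw [ENNReal.ofReal_mul (by positivity), ENNReal.ofReal_add (by positivity)
            (by positivity), ENNReal.ofReal_mul (by positivity), ENNReal.ofReal_natCast]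
          simp
          ring
      _ ≤ _ := by gcongr
  by_contra hne
  have hmeas : ∀ k, Measurable ((Ici (b k)).indicator fun x : ℝ => ENNReal.ofReal (x ^ 2)⁻¹) :=
    fun k => (by fun_prop : Measurable fun x : ℝ => ENNReal.ofReal (x ^ 2)⁻¹).indicator
      measurableSet_Ici
  have h1 : ∫⁻ x in Ioi a, ENNReal.ofReal (q x * (x ^ 2)⁻¹) ≤
      4 * ENNReal.ofReal a⁻¹ + 2 * ∑' k, ENNReal.ofReal (b k)⁻¹ := by
    refine (setLIntegral_mono (by fun_prop) hpt).trans ?_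
    rw [lintegral_add_left (by fun_prop), lintegral_const_mul _ (by fun_prop),
      lintegral_const_mul _ (by fun_prop), lintegral_tsum fun k => (hmeas k).aemeasurable,
      lintegral_Ioi_inv_sq ha]
    gcongr with k
    refine (setLIntegral_le_lintegral _ _).trans ?_
    rw [lintegral_indicator measurableSet_Ici, ← setLIntegral_congr Ioi_ae_eq_Ici,
      lintegral_Ioi_inv_sq (ha.trans_le (hab k))]
  rw [hq, top_le_iff] at h1
  exact ENNReal.add_ne_top.2 ⟨ENNReal.mul_ne_top (by simp) (by simp),
    ENNReal.mul_ne_top (by simp) hne⟩ h1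

/-- The root of the constant `3` is bounded by `3` itself, uniformly in `k`; constant factors do not
affect divergence. -/
theorem inv_le_moment_rpow {μ : Measure ℝ} {k : ℕ} {b : ℝ} (hb : 0 < b)
    (h : ENNReal.ofReal (moment μ (2 * (k + 1))) ≤ ENNReal.ofReal (3 * b ^ (2 * (k + 1)))) :
    ENNReal.ofReal 3⁻¹ * ENNReal.ofReal b⁻¹ ≤
      ENNReal.ofReal (moment μ (2 * (k + 1))) ^ (-1 / (2 * ((k : ℝ) + 1))) := by
  have h1 : 3 * b ^ (2 * (k + 1)) ≤ (3 * b) ^ (2 * (k + 1)) := by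
    rw [mul_pow]
    gcongr
    exact le_self_pow₀ (by norm_num) (by omega)
  rw [← ENNReal.ofReal_mul (by positivity), ← mul_inv, ENNReal.ofReal_inv_of_pos (by positivity),
    neg_div, ENNReal.rpow_neg, ENNReal.inv_le_inv]
  calc _ ≤ ENNReal.ofReal ((3 * b) ^ (2 * (k + 1))) ^ (1 / (2 * ((k : ℝ) + 1))) := by
        exact ENNReal.rpow_le_rpow (h.trans (ENNReal.ofReal_le_ofReal h1)) (by positivity)
    _ = ENNReal.ofReal (3 * b) := by
        rw [ENNReal.ofReal_pow (by positivity), ← ENNReal.rpow_natCast, ← ENNReal.rpow_mul]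
        push_cast
        rw [mul_one_div_cancel (by positivity), ENNReal.rpow_one]

theorem carleman_of_symmetric_of_Kstar {μ : Measure ℝ} [IsProbabilityMeasure μ]
    (hs : SymmetricLaw μ) {a : ℝ} (ha : 1 < a) {f : ℝ → ℝ} (hdens : HasDensityFrom μ a f)
    (hcont : ContinuousOn f (Ici a)) (hpos : ∀ x ∈ Ici a, 0 < f x) (hK : Kstar a f = ⊤)
    (hmono : MonotoneOn (fun x => -Real.log (f x) / Real.log x) (Ici a))
    (hlim : Tendsto (fun x => -Real.log (f x) / Real.log x) atTop atTop) : Carleman μ := by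
  have ha0 : 0 < a := by linarith
  have hbound : ∀ (m : ℕ) (b : ℝ), a ≤ b →
      (∀ x, b < x → (m : ℝ) + 2 < -Real.log (f x) / Real.log x) →
      ∫⁻ x, ENNReal.ofReal (|x| ^ m) ∂μ ≤ ENNReal.ofReal (3 * b ^ m) := by
    intro m b hab hb
    refine lintegral_abs_pow_le hs ha hab hdens hcont m fun x hx => ?_
    have hax : a ≤ x := hab.trans hx.le
    refine le_inv_pow_of_lt_neg_log_div_log (hpos x hax) (ha.trans_le hax) (m + 2) ?_
    push_cast
    exact hb x hx
  refine ⟨fun m => ?_, ?_⟩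
  · obtain ⟨b, hab, hb, -⟩ := exists_threshold hmono hlim ((m : ℝ) + 2)
    refine ⟨by fun_prop, ?_⟩
    rw [hasFiniteIntegral_iff_norm]
    simp only [norm_pow, Real.norm_eq_abs]
    exact (hbound m b hab hb).trans_lt ENNReal.ofReal_lt_top
  -- The level is the order `2 (k + 1)` of the moment plus the `2` that makes the tail integrable.
  · choose b hab hb hb' using fun k : ℕ => exists_threshold hmono hlim (2 * (k : ℝ) + 4)
    have htop := tsum_inv_threshold_eq_top ha0 (lintegral_eq_top_of_Kstar ha0 hK) hab hb'
    have hle : ENNReal.ofReal 3⁻¹ * ∑' k, ENNReal.ofReal (b k)⁻¹ ≤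
        ∑' k : ℕ, ENNReal.ofReal (moment μ (2 * (k + 1))) ^ (-1 / (2 * ((k : ℝ) + 1))) := by
      rw [← ENNReal.tsum_mul_left]
      refine ENNReal.tsum_le_tsum fun k => inv_le_moment_rpow (ha0.trans_le (hab k)) ?_
      refine le_trans (le_of_eq ?_) (hbound (2 * (k + 1)) (b k) (hab k) fun x hx => ?_)
      · have heven : ∀ x : ℝ, |x| ^ (2 * (k + 1)) = x ^ (2 * (k + 1)) := fun x =>
          (even_two_mul _).pow_abs x
        simp_rw [heven]
        rw [moment, integral_eq_lintegral_of_nonneg_ae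
          (ae_of_all _ fun x => (even_two_mul _).pow_nonneg x) (by fun_prop),
          ENNReal.ofReal_toReal]
        -- Finiteness is needed here because `ENNReal.toReal` sends `∞` to `0`.
        obtain ⟨c, hac, hc, -⟩ :=
          exists_threshold hmono hlim (((2 * (k + 1) : ℕ) : ℝ) + 2)
        have := hbound _ c hac hc
        simp_rw [heven] at this
        exact (this.trans_lt ENNReal.ofReal_lt_top).ne
      · have := hb k x hx
        push_cast
        linarith
    rwa [htop, ENNReal.mul_top (by simp), top_le_iff] at hle

/-- A law with a positive density on a half-line is not concentrated at the origin. -/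
theorem compl_zero_ne_zero_of_density {μ : Measure ℝ} {a : ℝ} (ha : 0 < a) {f : ℝ → ℝ}
    (hdens : HasDensityFrom μ a f) (hcont : ContinuousOn f (Ici a))
    (hpos : ∀ x ∈ Ici a, 0 < f x) : μ {0}ᶜ ≠ 0 := by
  intro h
  have h1 : μ.restrict (Ioi a) = 0 := by
    rw [Measure.restrict_eq_zero]
    refine measure_mono_null (fun x (hx : a < x) => ?_) h
    exact (ha.trans hx).ne'
  have hfm : AEMeasurable (fun x => ENNReal.ofReal (f x)) (volume.restrict (Ioi a)) :=
    ((hcont.mono Ioi_subset_Ici_self).aemeasurable measurableSet_Ioi).ennreal_ofReal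
  rw [hdens, withDensity_eq_zero_iff hfm, EventuallyEq, ae_restrict_iff' measurableSet_Ioi] at h1
  have h2 : volume (Ioi a) = 0 := by
    refine measure_mono_null (fun x (hx : a < x) => ?_) (ae_iff.1 h1)
    simpa using And.intro hx (hpos x hx.le)
  simp at h2

end MomentProblem

theorem mainTheorem5 {Ω : Type*} [MeasurableSpace Ω] (P : Measure Ω) [IsProbabilityMeasure P]
    (X : Ω → ℝ) (hX : AEMeasurable X P)
    (hsymm : MomentProblem.SymmetricLaw (P.map X))
    (x₀ : ℝ) (hx₀ : 1 < x₀) (f : ℝ → ℝ)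
    (hdens : MomentProblem.HasDensityFrom (P.map X) x₀ f)
    (hcont : ContinuousOn f (Ici x₀))
    (hpos : ∀ x ∈ Ici x₀, 0 < f x)
    (hK : MomentProblem.Kstar x₀ f = ⊤)
    (hmono : MonotoneOn (fun x => -Real.log (f x) / Real.log x) (Ici x₀))
    (hlim : Tendsto (fun x => -Real.log (f x) / Real.log x) atTop atTop) :
    MomentProblem.Carleman (P.map X) ∧
      MomentProblem.MDeterminateOn univ (P.map X) ∧
      MomentProblem.MDeterminateOn (Ici 0) (P.map (fun ω => X ω ^ 2)) := by
  have hprob : IsProbabilityMeasure (P.map X) := Measure.isProbabilityMeasure_map hX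
  have hC := MomentProblem.carleman_of_symmetric_of_Kstar hsymm hx₀ hdens hcont hpos hK hmono hlim
  have hdet := hC.mDeterminateOn_univ
    (MomentProblem.compl_zero_ne_zero_of_density (by linarith) hdens hcont hpos)
  refine ⟨hC, hdet, ?_⟩
  have := hdet.map_sq hsymm
  rwa [AEMeasurable.map_map_of_aemeasurable (by fun_prop) hX] at this
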